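/- For every integer $n \ge 3$ there exists a convex polygon $P_n$ in the Euclidean plane (the convex hull of finitely many points, with non-empty interior) such that for any $n$ vertices $v_1, \dots, v_n$ of $P_n$, not necessarily distinct, there is a path (a continuous curve in the plane) that passes through all of $v_1, \dots, v_n$ and has length less than $\frac12 \operatorname{per} P_n$, where $\operatorname{per} P_n$ denotes the perimeter of $P_n$. -/

import Mathlib

open Set MeasureTheory
open scoped ENNReal

/-- The Euclidean plane. -/
abbrev Plane : Type := EuclideanSpace ℝ (Fin 2)

/-- A (non-degenerate) convex polygon in the plane, as a closed region: the convex hull of finitely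
many points, with nonempty interior. -/
def IsConvexPolygon (P : Set Plane) : Prop :=
  (∃ S : Set Plane, S.Finite ∧ P = convexHull ℝ S) ∧ (interior P).Nonempty

/-- The vertices of a convex polygon are its extreme points. -/
def vertices (P : Set Plane) : Set Plane := P.extremePoints ℝ

/-- The perimeter: the length (one-dimensional Hausdorff measure) of the boundary. In Mathlib's
normalization the measure of a segment is its Euclidean length. -/
noncomputable def perimeter (P : Set Plane) : ℝ≥0∞ := μH[1] (frontier P)

/-- Some path (a continuous curve) of length less than `L` passes through all points of `A`. -/
def JoinedByPathShorterThan (A : Set Plane) (L : ℝ≥0∞) : Prop :=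
  ∃ (a b : ℝ) (γ : ℝ → Plane), a ≤ b ∧ ContinuousOn γ (Icc a b) ∧ A ⊆ γ '' Icc a b ∧
    eVariationOn γ (Icc a b) < L

/-! Take points of the parabola `x = y ^ 2` at heights `2 ^ k`, `k ≤ N`. A chord between heights `u
< v` exceeds its horizontal extent by about `(v - u) / (2 * (u + v))`: always at most `1 / 2`
(`dist_dyadicPoint_le`), yet bounded below for consecutive points (`le_dist_dyadicPoint_succ`).
Visiting `n` vertices from left to right thus costs at most `4 ^ N - 1 + n / 2`, while half the
perimeter is at least `4 ^ N - 1 + N / 24` (`le_perimeter_dyadicPolygon`), which wins once `N` is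
large compared to `n`. -/

/-- The affine segment from `p` to `q`, traversed over the time interval `[a, b]`. -/
noncomputable def segmentPath {E : Type*} [NormedAddCommGroup E] [NormedSpace ℝ E]
    (p q : E) (a b : ℝ) (t : ℝ) : E :=
  AffineMap.lineMap p q ((t - a) / (b - a))

lemma continuous_segmentPath {E : Type*} [NormedAddCommGroup E] [NormedSpace ℝ E]
    (p q : E) (a b : ℝ) : Continuous (segmentPath p q a b) := by
  unfold segmentPath
  exact AffineMap.lineMap_continuous.comp (by fun_prop)

lemma eVariationOn_segmentPath_le {E : Type*} [NormedAddCommGroup E] [NormedSpace ℝ E]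
    (p q : E) {a b : ℝ} (hab : a < b) :
    eVariationOn (segmentPath p q a b) (Icc a b) ≤ edist p q := by
  have hba : 0 < b - a := sub_pos.2 hab
  have hmono : MonotoneOn (fun t : ℝ => (t - a) / (b - a)) (Icc a b) := by
    intro s _ t _ hst
    dsimp only
    gcongr
  have hvar : eVariationOn (fun t : ℝ => (t - a) / (b - a)) (Icc a b) ≤ 1 := by
    have h := hmono.eVariationOn_eq (left_mem_Icc.2 hab.le) (right_mem_Icc.2 hab.le)
    rw [inter_self] at h
    rw [h, sub_self, zero_div, sub_zero, div_self hba.ne', ENNReal.ofReal_one]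
  have hlip : LipschitzOnWith (nndist p q) (AffineMap.lineMap p q : ℝ → E) univ :=
    (lipschitzWith_lineMap p q).lipschitzOnWith
  calc eVariationOn (segmentPath p q a b) (Icc a b)
      ≤ nndist p q * eVariationOn (fun t : ℝ => (t - a) / (b - a)) (Icc a b) :=
        hlip.comp_eVariationOn_le (mapsTo_univ _ _)
    _ ≤ nndist p q * 1 := by gcongr
    _ = edist p q := by rw [mul_one, edist_nndist]

/-- If the increments of a sequence of points are bounded by those of a real sequence, up to a fixed
error, then any finite set of its terms lies on a polygonal path with the accumulated bound. -/
lemma exists_path_through_finset {E : Type*} [NormedAddCommGroup E] [NormedSpace ℝ E]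
    (p : ℕ → E) (g : ℕ → ℝ) {δ : ℝ} (hδ : 0 ≤ δ) (hg : Monotone g)
    (hp : ∀ a b, a < b → dist (p a) (p b) ≤ g b - g a + δ) (K : Finset ℕ) :
    ∃ (m : ℕ) (γ : ℝ → E), (m ∈ K ∨ m = 0) ∧ (∀ k ∈ K, k ≤ m) ∧ ContinuousOn γ (Icc 0 (m : ℝ)) ∧
      (∀ k ∈ K, γ k = p k) ∧ γ m = p m ∧
      eVariationOn γ (Icc 0 (m : ℝ)) ≤ ENNReal.ofReal (g m - g 0 + K.card * δ) := by
  induction K using Finset.induction_on_max with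
  | empty =>
    -- Every path starts at `p 0`, even if `0 ∉ K`, so each index costs at most one edge.
    refine ⟨0, fun _ => p 0, by simp, by simp, continuousOn_const, by simp, rfl, ?_⟩
    rw [eVariationOn.subsingleton _ (by simp)]
    exact zero_le
  | insert c K hc ih =>
    obtain ⟨m, γ, hm, hKm, hcont, hγ, hγm, hvar⟩ := ih
    have hcK : c ∉ K := fun h => lt_irrefl _ (hc c h)
    have hmc : m ≤ c := by
      rcases hm with hm | rfl
      · exact (hc m hm).le
      · exact Nat.zero_le c
    rcases hmc.eq_or_lt with rfl | hlt
    -- Since `c` exceeds all of `K`, equality forces `K = ∅` and `c = 0`.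
    · refine ⟨m, γ, by simp, ?_, hcont, ?_, hγm, hvar.trans (ENNReal.ofReal_le_ofReal ?_)⟩
      · simpa using hKm
      · simpa using ⟨hγm, hγ⟩
      · rw [Finset.card_insert_of_notMem hcK]
        push_cast
        nlinarith
    · have hlt' : (m : ℝ) < c := by exact_mod_cast hlt
      set σ := segmentPath (p m) (p c) (m : ℝ) (c : ℝ) with hσ
      have hσm : σ m = p m := by simp [hσ, segmentPath]
      have hσc : σ c = p c := by
        simp [hσ, segmentPath, div_self (sub_pos.2 hlt').ne']
      set η : ℝ → E := fun t => if t ≤ m then γ t else σ t with hη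
      have hη₁ : EqOn η γ (Icc 0 (m : ℝ)) := fun t ht => if_pos ht.2
      have hη₂ : EqOn η σ (Icc (m : ℝ) c) := by
        intro t ht
        rcases ht.1.eq_or_lt with h | h
        · rw [← h, hσm, ← hγm]
          exact if_pos le_rfl
        · exact if_neg (not_le.2 h)
      have hIcc : Icc 0 (m : ℝ) ∪ Icc (m : ℝ) c = Icc 0 (c : ℝ) :=
        Icc_union_Icc_eq_Icc m.cast_nonneg hlt'.le
      have hηc : η c = p c := (hη₂ (right_mem_Icc.2 hlt'.le)).trans hσc
      refine ⟨c, η, by simp, ?_, ?_, ?_, hηc, ?_⟩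
      · intro k hk
        rcases Finset.mem_insert.1 hk with rfl | hk
        exacts [le_rfl, (hc k hk).le]
      · rw [← hIcc]
        exact (hcont.congr hη₁).union_of_isClosed
          ((continuous_segmentPath _ _ _ _).continuousOn.congr hη₂) isClosed_Icc isClosed_Icc
      · intro k hk
        rcases Finset.mem_insert.1 hk with rfl | hk
        · exact hηc
        · rw [hη₁ ⟨k.cast_nonneg, by exact_mod_cast hKm k hk⟩, hγ k hk]
      · have hunion := eVariationOn.union η (s := Icc 0 (m : ℝ)) (t := Icc (m : ℝ) c)
          (isGreatest_Icc m.cast_nonneg) (isLeast_Icc hlt'.le)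
        rw [hIcc] at hunion
        rw [hunion, eVariationOn.congr hη₁, eVariationOn.congr hη₂,
          Finset.card_insert_of_notMem hcK]
        have h0m : g 0 ≤ g m := hg (Nat.zero_le m)
        have hmc' : g m ≤ g c := hg hmc
        calc _ ≤ ENNReal.ofReal (g m - g 0 + K.card * δ) + ENNReal.ofReal (g c - g m + δ) := by
              refine add_le_add hvar ((eVariationOn_segmentPath_le _ _ hlt').trans ?_)
              rw [edist_dist]
              exact ENNReal.ofReal_le_ofReal (hp m c hlt)
          _ = ENNReal.ofReal (g c - g 0 + ((K.card + 1 : ℕ) : ℝ) * δ) := by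
              rw [← ENNReal.ofReal_add (by have := sub_nonneg.2 h0m; positivity) (by linarith)]
              congr 1
              push_cast
              ring

/-! ### Points on the parabola and chord lengths -/

/-- The points of the parabola `x = y ^ 2` at dyadic heights. -/
noncomputable def dyadicPoint (k : ℕ) : Plane := !₂[(4 : ℝ) ^ k, (2 : ℝ) ^ k]

@[simp] lemma dyadicPoint_zero_apply (k : ℕ) : dyadicPoint k 0 = (4 : ℝ) ^ k := rfl

@[simp] lemma dyadicPoint_one_apply (k : ℕ) : dyadicPoint k 1 = (2 : ℝ) ^ k := rfl

lemma four_pow_eq_two_pow_sq (k : ℕ) : (4 : ℝ) ^ k = ((2 : ℝ) ^ k) ^ 2 := by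
  rw [← pow_mul, mul_comm, pow_mul]
  norm_num

lemma dist_dyadicPoint (a b : ℕ) : dist (dyadicPoint a) (dyadicPoint b) =
    √(((4 : ℝ) ^ a - 4 ^ b) ^ 2 + ((2 : ℝ) ^ a - 2 ^ b) ^ 2) := by
  rw [EuclideanSpace.dist_eq]
  simp [Fin.sum_univ_two, Real.dist_eq, sq_abs]

lemma dist_dyadicPoint_le {a b : ℕ} (hab : a < b) :
    dist (dyadicPoint a) (dyadicPoint b) ≤ (4 : ℝ) ^ b - 4 ^ a + 1 / 2 := by
  have ha : (1 : ℝ) ≤ 2 ^ a := one_le_pow₀ (by norm_num)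
  have h : (2 : ℝ) ^ a ≤ 2 ^ b := pow_le_pow_right₀ (by norm_num) hab.le
  rw [dist_dyadicPoint, four_pow_eq_two_pow_sq, four_pow_eq_two_pow_sq]
  apply Real.sqrt_le_iff.2
  generalize (2 : ℝ) ^ a = u at *
  generalize (2 : ℝ) ^ b = v at *
  constructor <;> nlinarith

lemma le_dist_dyadicPoint (a b : ℕ) :
    (4 : ℝ) ^ b - 4 ^ a ≤ dist (dyadicPoint a) (dyadicPoint b) := by
  rw [dist_dyadicPoint]
  apply Real.le_sqrt_of_sq_le
  nlinarith [sq_nonneg ((2 : ℝ) ^ a - 2 ^ b)]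

lemma le_dist_dyadicPoint_succ (k : ℕ) :
    (4 : ℝ) ^ (k + 1) - 4 ^ k + 1 / 12 ≤ dist (dyadicPoint k) (dyadicPoint (k + 1)) := by
  have ha : (1 : ℝ) ≤ 2 ^ k := one_le_pow₀ (by norm_num)
  rw [dist_dyadicPoint]
  apply Real.le_sqrt_of_sq_le
  rw [pow_succ (4 : ℝ), pow_succ (2 : ℝ), four_pow_eq_two_pow_sq]
  generalize (2 : ℝ) ^ k = u at *
  nlinarith

/-! ### Linear forms of chords -/

/-- The equation of the line through the points of the parabola `x = y ^ 2` at heights `u`, `v`. -/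
def chordForm (u v : ℝ) (p : Plane) : ℝ := p 0 - (u + v) * p 1 + u * v

lemma continuous_chordForm (u v : ℝ) : Continuous (chordForm u v) := by
  unfold chordForm
  fun_prop

lemma chordForm_combo (u v : ℝ) (p q : Plane) {a b : ℝ} (hab : a + b = 1) :
    chordForm u v (a • p + b • q) = a * chordForm u v p + b * chordForm u v q := by
  obtain rfl : b = 1 - a := by linarith
  simp only [chordForm, PiLp.add_apply, PiLp.smul_apply, smul_eq_mul]
  ring

/-- This factorization turns the position of a vertex relative to a chord into a comparison of
heights. -/
lemma chordForm_dyadicPoint (u v : ℝ) (k : ℕ) :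
    chordForm u v (dyadicPoint k) = ((2 : ℝ) ^ k - u) * (2 ^ k - v) := by
  simp only [chordForm, dyadicPoint_zero_apply, dyadicPoint_one_apply, four_pow_eq_two_pow_sq]
  ring

lemma convex_chordForm_nonneg (u v : ℝ) : Convex ℝ {p | 0 ≤ chordForm u v p} := by
  intro p hp q hq a b ha hb hab
  rw [mem_ofPred_eq] at *
  rw [chordForm_combo u v p q hab]
  positivity

lemma convex_chordForm_nonpos (u v : ℝ) : Convex ℝ {p | chordForm u v p ≤ 0} := by
  intro p hp q hq a b ha hb hab
  rw [mem_ofPred_eq] at *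
  rw [chordForm_combo u v p q hab]
  have := mul_nonpos_of_nonneg_of_nonpos ha hp
  have := mul_nonpos_of_nonneg_of_nonpos hb hq
  linarith

lemma chordForm_segment_eq_zero {u v : ℝ} {p q x : Plane} (hp : chordForm u v p = 0)
    (hq : chordForm u v q = 0) (hx : x ∈ segment ℝ p q) : chordForm u v x = 0 := by
  obtain ⟨a, b, -, -, hab, rfl⟩ := hx
  rw [chordForm_combo u v p q hab, hp, hq]
  ring

lemma chordForm_translate (u v c : ℝ) (p : Plane) :
    chordForm u v (p + c • !₂[1, 0]) = chordForm u v p + c := by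
  simp [chordForm]
  ring

/-- A zero of `chordForm u v` is not interior to a set on which this form has constant sign. -/
lemma notMem_interior_of_chordForm {u v s : ℝ} (hs : s ≠ 0) {P : Set Plane} {x : Plane}
    (hP : ∀ p ∈ P, 0 ≤ s * chordForm u v p) (hx : chordForm u v x = 0) : x ∉ interior P := by
  intro hxi
  -- A horizontal shift by `-(c * s)` changes `s * chordForm u v` by `-c * s ^ 2 < 0`.
  have hcont : Filter.Tendsto (fun c : ℝ => x + (-(c * s)) • (!₂[1, 0] : Plane)) (nhds 0)
      (nhds x) := by
    have : Continuous (fun c : ℝ => x + (-(c * s)) • (!₂[1, 0] : Plane)) := by fun_prop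
    simpa using this.tendsto 0
  have hev := (hcont.eventually (mem_interior_iff_mem_nhds.1 hxi)).filter_mono
    (nhdsWithin_le_nhds (s := Ioi 0))
  obtain ⟨c, hc, hc0⟩ := (hev.and self_mem_nhdsWithin).exists
  have := hP _ hc
  rw [chordForm_translate, hx] at this
  have h2 : 0 < c * s ^ 2 := mul_pos hc0 (by positivity)
  nlinarith

/-! ### The polygon and its boundary -/

/-- The convex polygon inscribed in the parabola `x = y ^ 2` with vertices at heights
`1, 2, 4, …, 2 ^ N`. -/
def dyadicPolygon (N : ℕ) : Set Plane := convexHull ℝ (dyadicPoint '' Iic N)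

lemma dyadicPoint_mem {N k : ℕ} (hk : k ≤ N) : dyadicPoint k ∈ dyadicPolygon N :=
  subset_convexHull ℝ _ ⟨k, hk, rfl⟩

lemma interior_dyadicPolygon_nonempty {N : ℕ} (hN : 2 ≤ N) :
    (interior (dyadicPolygon N)).Nonempty := by
  let U : Set Plane := {p | 0 < chordForm 1 2 p} ∩ {p | 0 < chordForm 2 4 p} ∩
    {p | chordForm 1 4 p < 0}
  have hU : IsOpen U := ((isOpen_lt continuous_const (continuous_chordForm 1 2)).inter
    (isOpen_lt continuous_const (continuous_chordForm 2 4))).inter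
    (isOpen_lt (continuous_chordForm 1 4) continuous_const)
  have hUP : U ⊆ dyadicPolygon N := by
    rintro p ⟨⟨h₁, h₂⟩, h₃⟩
    rw [mem_ofPred_eq] at h₁ h₂ h₃
    -- Barycentric coordinates: each form is divided by its value at the opposite vertex.
    have hp : p = (chordForm 2 4 p / 3) • dyadicPoint 0 + (-chordForm 1 4 p / 2) • dyadicPoint 1 +
        (chordForm 1 2 p / 6) • dyadicPoint 2 := by
      ext i
      fin_cases i <;>
      · simp [chordForm]
        ring
    have hmem := (convex_convexHull ℝ (dyadicPoint '' Iic N)).sum_mem (t := Finset.univ)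
      (w := ![chordForm 2 4 p / 3, -chordForm 1 4 p / 2, chordForm 1 2 p / 6])
      (z := fun i : Fin 3 => dyadicPoint i)
      (by intro i _
          fin_cases i <;> simp <;> linarith)
      (by simp only [Fin.sum_univ_three, chordForm, Matrix.cons_val]; ring)
      (fun i _ => dyadicPoint_mem (by omega))
    rw [hp]
    simpa [Fin.sum_univ_three, dyadicPolygon] using hmem
  -- The centroid of the first three vertices.
  refine ⟨!₂[7, 7 / 3], interior_maximal hUP hU ⟨⟨?_, ?_⟩, ?_⟩⟩ <;>
    norm_num [chordForm]

lemma isConvexPolygon_dyadicPolygon {N : ℕ} (hN : 2 ≤ N) : IsConvexPolygon (dyadicPolygon N) :=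
  ⟨⟨_, (finite_Iic N).image _, rfl⟩, interior_dyadicPolygon_nonempty hN⟩

lemma segment_subset_frontier_dyadicPolygon {N j k : ℕ} (hj : j ≤ N) (hk : k ≤ N) {s : ℝ}
    (hs : s ≠ 0) (h : ∀ p ∈ dyadicPolygon N, 0 ≤ s * chordForm (2 ^ j) (2 ^ k) p) :
    segment ℝ (dyadicPoint j) (dyadicPoint k) ⊆ frontier (dyadicPolygon N) := by
  intro x hx
  refine ⟨subset_closure ((convex_convexHull ℝ _).segment_subset (dyadicPoint_mem hj)
    (dyadicPoint_mem hk) hx), notMem_interior_of_chordForm hs h ?_⟩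
  exact chordForm_segment_eq_zero (by simp [chordForm_dyadicPoint])
    (by simp [chordForm_dyadicPoint]) hx

/-- No power of two lies strictly between consecutive ones, so both factors have the same sign at
every vertex. -/
lemma chordForm_succ_nonneg {N k : ℕ} {p : Plane} (hp : p ∈ dyadicPolygon N) :
    0 ≤ chordForm (2 ^ k) (2 ^ (k + 1)) p := by
  refine convexHull_min (t := {p | 0 ≤ chordForm (2 ^ k) (2 ^ (k + 1)) p}) ?_
    (convex_chordForm_nonneg _ _) hp
  rintro _ ⟨i, -, rfl⟩
  rw [mem_ofPred_eq, chordForm_dyadicPoint]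
  rcases le_or_gt i k with h | h
  · exact mul_nonneg_of_nonpos_of_nonpos
      (sub_nonpos.2 (pow_le_pow_right₀ (by norm_num) h))
      (sub_nonpos.2 (pow_le_pow_right₀ (by norm_num) (by omega)))
  · exact mul_nonneg (sub_nonneg.2 (pow_le_pow_right₀ (by norm_num) h.le))
      (sub_nonneg.2 (pow_le_pow_right₀ (by norm_num) h))

lemma chordForm_ends_nonpos {N : ℕ} {p : Plane} (hp : p ∈ dyadicPolygon N) :
    chordForm (2 ^ 0) (2 ^ N) p ≤ 0 := by
  refine convexHull_min (t := {p | chordForm (2 ^ 0) (2 ^ N) p ≤ 0}) ?_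
    (convex_chordForm_nonpos _ _) hp
  rintro _ ⟨i, hi, rfl⟩
  rw [mem_ofPred_eq, chordForm_dyadicPoint]
  exact mul_nonpos_of_nonneg_of_nonpos
    (sub_nonneg.2 (pow_le_pow_right₀ (by norm_num) (Nat.zero_le i)))
    (sub_nonpos.2 (pow_le_pow_right₀ (by norm_num) hi))

lemma isClosed_segment_plane (p q : Plane) : IsClosed (segment ℝ p q) := by
  rw [← convexHull_pair (𝕜 := ℝ)]
  exact (((finite_singleton q).insert p).isCompact_convexHull ℝ).isClosed

lemma height_mem_Icc {j k : ℕ} (hjk : j ≤ k) {x : Plane}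
    (hx : x ∈ segment ℝ (dyadicPoint j) (dyadicPoint k)) :
    x 1 ∈ Icc ((2 : ℝ) ^ j) (2 ^ k) := by
  obtain ⟨a, b, ha, hb, hab, rfl⟩ := hx
  have h : (2 : ℝ) ^ j ≤ 2 ^ k := pow_le_pow_right₀ (by norm_num) hjk
  obtain rfl : a = 1 - b := by linarith
  simp only [PiLp.add_apply, PiLp.smul_apply, smul_eq_mul, dyadicPoint_one_apply]
  constructor <;> nlinarith

lemma chain_inter_subset {j k : ℕ} (hjk : j < k) :
    segment ℝ (dyadicPoint j) (dyadicPoint (j + 1)) ∩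
      segment ℝ (dyadicPoint k) (dyadicPoint (k + 1)) ⊆ {dyadicPoint k} := by
  rintro x ⟨hx, hx'⟩
  have h₁ := (height_mem_Icc (Nat.le_succ j) hx).2
  have h₂ : (2 : ℝ) ^ (j + 1) ≤ 2 ^ k := pow_le_pow_right₀ (by norm_num) hjk
  obtain ⟨a, b, ha, hb, hab, rfl⟩ := hx'
  obtain rfl : a = 1 - b := by linarith
  simp only [PiLp.add_apply, PiLp.smul_apply, smul_eq_mul, dyadicPoint_one_apply, pow_succ] at h₁ h₂
  have hk : (0 : ℝ) < 2 ^ k := by positivity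
  obtain rfl : b = 0 := by nlinarith
  simp

/-- The form of the long chord is negative at every intermediate vertex, so on the chain it vanishes
only at the two ends. -/
lemma chord_inter_chain_subset {N k : ℕ} (hN : 2 ≤ N) (hk : k < N) :
    segment ℝ (dyadicPoint 0) (dyadicPoint N) ∩
      segment ℝ (dyadicPoint k) (dyadicPoint (k + 1)) ⊆ {dyadicPoint 0, dyadicPoint N} := by
  rintro x ⟨hx, hx'⟩
  have h0 : chordForm (2 ^ 0) (2 ^ N) x = 0 :=
    chordForm_segment_eq_zero (by simp [chordForm_dyadicPoint])
      (by simp [chordForm_dyadicPoint]) hx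
  have hneg : ∀ i, 0 < i → i < N → chordForm (2 ^ 0) (2 ^ N) (dyadicPoint i) < 0 := by
    intro i hi hiN
    rw [chordForm_dyadicPoint]
    exact mul_neg_of_pos_of_neg (sub_pos.2 (pow_lt_pow_right₀ (by norm_num) hi))
      (sub_neg.2 (pow_lt_pow_right₀ (by norm_num) hiN))
  have hle := fun i (hi : i ≤ N) => chordForm_ends_nonpos (dyadicPoint_mem hi)
  obtain ⟨a, b, ha, hb, hab, rfl⟩ := hx'
  rw [chordForm_combo _ _ _ _ hab] at h0
  have hA := mul_nonpos_of_nonneg_of_nonpos ha (hle k hk.le)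
  have hB := mul_nonpos_of_nonneg_of_nonpos hb (hle (k + 1) hk)
  rcases Nat.eq_zero_or_pos k with rfl | hk0
  · have hb0 : b = 0 := by
      by_contra hne
      have := mul_neg_of_pos_of_neg (lt_of_le_of_ne hb (Ne.symm hne))
        (hneg (0 + 1) (by omega) (by omega))
      linarith
    obtain rfl : a = 1 := by linarith
    simp [hb0]
  · have ha0 : a = 0 := by
      by_contra hne
      have := mul_neg_of_pos_of_neg (lt_of_le_of_ne ha (Ne.symm hne)) (hneg k hk0 hk)
      linarith
    obtain rfl : b = 1 := by linarith
    rcases (Nat.succ_le_of_lt hk).eq_or_lt with h | h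
    · simp [ha0, ← h]
    · have := hneg (k + 1) (by omega) h
      linarith

/-- The long chord and the sides lie in the frontier and overlap in finite, hence null, sets, so
their lengths add. That they fill the frontier is not needed. -/
lemma le_perimeter_dyadicPolygon {N : ℕ} (hN : 2 ≤ N) :
    ENNReal.ofReal (2 * ((4 : ℝ) ^ N - 1) + N / 12) ≤ perimeter (dyadicPolygon N) := by
  set side : ℕ → Set Plane := fun k => segment ℝ (dyadicPoint k) (dyadicPoint (k + 1)) with hside
  set base : Set Plane := segment ℝ (dyadicPoint 0) (dyadicPoint N) with hbase
  have hone : (1 : ℝ) ≤ 4 ^ N := one_le_pow₀ (by norm_num)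
  have : NullSingletonClass (μH[1] : Measure Plane) := Measure.nullSingletonClass_hausdorff Plane one_pos
  have hnull : ∀ {A B : Set Plane}, A ⊆ B → B.Finite → μH[1] A = 0 := fun hAB hB =>
    (hB.subset hAB).measure_zero _
  have hchain : μH[1] (⋃ k ∈ Finset.range N, side k) = ∑ k ∈ Finset.range N, μH[1] (side k) := by
    refine measure_biUnion_finset₀ ?_
      fun k _ => (isClosed_segment_plane _ _).measurableSet.nullMeasurableSet
    intro i _ j _ hij
    rcases hij.lt_or_gt with h | h
    · exact hnull (chain_inter_subset h) (finite_singleton _)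
    · exact (show AEDisjoint μH[1] (side j) (side i) from
        hnull (chain_inter_subset h) (finite_singleton _)).symm
  have hdisj : AEDisjoint μH[1] base (⋃ k ∈ Finset.range N, side k) := by
    refine hnull (B := {dyadicPoint 0, dyadicPoint N}) ?_ (toFinite _)
    rintro x ⟨hx, hx'⟩
    obtain ⟨k, hk, hxk⟩ := mem_iUnion₂.1 hx'
    exact chord_inter_chain_subset hN (Finset.mem_range.1 hk) ⟨hx, hxk⟩
  have hsub : base ∪ (⋃ k ∈ Finset.range N, side k) ⊆ frontier (dyadicPolygon N) := by
    refine union_subset ?_ (iUnion₂_subset fun k hk => ?_)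
    · refine segment_subset_frontier_dyadicPolygon (Nat.zero_le N) le_rfl
        (neg_ne_zero.2 one_ne_zero) fun p hp => ?_
      linarith [chordForm_ends_nonpos hp]
    · have hk := Finset.mem_range.1 hk
      refine segment_subset_frontier_dyadicPolygon hk.le hk one_ne_zero fun p hp => ?_
      linarith [chordForm_succ_nonneg (k := k) hp]
  calc ENNReal.ofReal (2 * ((4 : ℝ) ^ N - 1) + N / 12)
      = ENNReal.ofReal (4 ^ N - 1) + ENNReal.ofReal
          (∑ k ∈ Finset.range N, ((4 : ℝ) ^ (k + 1) - 4 ^ k + 1 / 12)) := by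
        rw [Finset.sum_add_distrib, Finset.sum_range_sub (fun k => (4 : ℝ) ^ k),
          ← ENNReal.ofReal_add (by linarith)]
        · congr 1
          simp
          ring
        · simp only [Finset.sum_const, Finset.card_range, pow_zero, nsmul_eq_mul]
          have := sub_nonneg.2 hone
          positivity
    _ ≤ μH[1] base + ∑ k ∈ Finset.range N, μH[1] (side k) := by
        refine add_le_add ?_ ?_
        · rw [hbase, hausdorffMeasure_segment, edist_dist]
          refine ENNReal.ofReal_le_ofReal ?_
          simpa using le_dist_dyadicPoint 0 N
        · simp only [hside, hausdorffMeasure_segment, edist_dist]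
          rw [← ENNReal.ofReal_sum_of_nonneg fun _ _ => dist_nonneg]
          exact ENNReal.ofReal_le_ofReal
            (Finset.sum_le_sum fun k _ => le_dist_dyadicPoint_succ k)
    _ = μH[1] (base ∪ ⋃ k ∈ Finset.range N, side k) := by
        rw [measure_union₀' (isClosed_segment_plane _ _).measurableSet.nullMeasurableSet hdisj,
          hchain]
    _ ≤ perimeter (dyadicPolygon N) := measure_mono hsub

theorem corollary1 (n : ℕ) (hn : 3 ≤ n) :
    ∃ P : Set Plane, IsConvexPolygon P ∧
      ∀ v : Fin n → Plane, (∀ i, v i ∈ vertices P) →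
        JoinedByPathShorterThan (Set.range v) (perimeter P / 2) := by
  -- Chosen so that `N / 24 = (n + 1) / 2 > n / 2`.
  obtain ⟨N, hN⟩ : ∃ N, N = 12 * (n + 1) := ⟨_, rfl⟩
  have hN2 : 2 ≤ N := by omega
  refine ⟨dyadicPolygon N, isConvexPolygon_dyadicPolygon hN2, fun v hv => ?_⟩
  have hidx : ∀ i, ∃ k ≤ N, dyadicPoint k = v i := fun i =>
    (extremePoints_convexHull_subset (hv i) : v i ∈ dyadicPoint '' Iic N)
  choose κ hκN hκ using hidx
  have hmono : Monotone fun k : ℕ => (4 : ℝ) ^ k := pow_right_mono₀ (by norm_num)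
  obtain ⟨m, γ, hm, hle, hcont, hγ, -, hvar⟩ := exists_path_through_finset dyadicPoint
    (fun k => (4 : ℝ) ^ k) (δ := 1 / 2) (by norm_num) hmono
    (fun a b hab => dist_dyadicPoint_le hab) (Finset.univ.image κ)
  have hmN : m ≤ N := by
    rcases hm with hm | rfl
    · obtain ⟨i, -, rfl⟩ := Finset.mem_image.1 hm
      exact hκN i
    · exact Nat.zero_le N
  have hmem : ∀ i, κ i ∈ Finset.univ.image κ := fun i =>
    Finset.mem_image_of_mem κ (Finset.mem_univ i)
  refine ⟨0, m, γ, m.cast_nonneg, hcont, ?_, ?_⟩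
  · rintro _ ⟨i, rfl⟩
    exact ⟨κ i, ⟨(κ i).cast_nonneg, by exact_mod_cast hle _ (hmem i)⟩,
      (hγ _ (hmem i)).trans (hκ i)⟩
  · have hcard : ((Finset.univ.image κ).card : ℝ) ≤ n := by
      exact_mod_cast Finset.card_image_le.trans (by simp)
    have h4 : (4 : ℝ) ^ m ≤ 4 ^ N := hmono hmN
    have hone : (1 : ℝ) ≤ 4 ^ N := one_le_pow₀ (by norm_num)
    have hNn : (N : ℝ) = 12 * (n + 1) := by exact_mod_cast hN
    calc eVariationOn γ (Icc 0 (m : ℝ))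
        ≤ ENNReal.ofReal ((4 : ℝ) ^ m - 4 ^ 0 + (Finset.univ.image κ).card * (1 / 2)) := hvar
      _ < ENNReal.ofReal ((2 * ((4 : ℝ) ^ N - 1) + N / 12) / 2) := by
          refine (ENNReal.ofReal_lt_ofReal_iff (by rw [hNn]; linarith)).2 ?_
          rw [hNn, pow_zero]
          linarith
      _ = ENNReal.ofReal (2 * ((4 : ℝ) ^ N - 1) + N / 12) / 2 := by
          rw [ENNReal.ofReal_div_of_pos two_pos, ENNReal.ofReal_ofNat]
      _ ≤ perimeter (dyadicPolygon N) / 2 :=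
          ENNReal.div_le_div_right (le_perimeter_dyadicPolygon hN2) 2
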